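/- Let $[\pm1]=[-1,1]$. A database is a matrix $D\in\{\pm1\}^{n\times d}$ with rows $D_1,\dots,D_n$, and its one-way marginals are $\overline D=\frac1n\sum_{i=1}^n D_i\in[\pm1]^d$. A randomized mechanism $M:\{\pm1\}^{n\times d}\to[\pm1]^d$ is $(\varepsilon,\delta)$-differentially private if $\Pr[M(D)\in S]\le e^{\varepsilon}\Pr[M(D')\in S]+\delta$ for all databases $D,D'$ that differ only in a single row and all measurable $S\subseteq[\pm1]^d$. (1) For all constants $c,\gamma>0$ there are $K>0$ and $n_0$, depending only on $c$ and $\gamma$, such that the following holds for all $n\ge n_0$, all $d$, and all $\delta$ with $2^{-cn}\le\delta\le 1/n^{1+\gamma}$. If $M:\{\pm1\}^{n\times d}\to[\pm1]^d$ is $(1,\delta)$-differentially private and $\mathbb E_M\|M(D)-\overline D\|_1\le d/10$ for every $D\in\{\pm1\}^{n\times d}$, then $$d\le K\,\frac{n^2}{\log(1/\delta)}.$$ (2) For all constants $c,\gamma,\varepsilon_0>0$ there are $\kappa>0$ and $n_0$, depending only on $c,\gamma,\varepsilon_0$, such that the following holds for all $n\ge n_0$, all $d$, all $0<\varepsilon\le\varepsilon_0$,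 all $0<\alpha\le 1/10$, and all $\delta$ with $2^{-c\varepsilon\alpha n}\le\delta\le 1/n^{1+\gamma}$. If $M:\{\pm1\}^{n\times d}\to[\pm1]^d$ is $(\varepsilon,\delta)$-differentially private and $\mathbb E_M\|M(D)-\overline D\|_1\le\alpha d$ for every $D\in\{\pm1\}^{n\times d}$, then $$n\ge\kappa\,\frac{\sqrt{d\log(1/\delta)}}{\varepsilon\alpha}.$$ -/

import Mathlib

open MeasureTheory

/-- Databases `D ∈ {±1}^{n × d}`: `D i` is the `i`-th row. The type `ℤˣ` is `{1, -1}`. -/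
abbrev Database (n d : ℕ) : Type := Fin n → Fin d → ℤˣ

/-- The cube `[-1, 1]^d`. -/
abbrev Cube (d : ℕ) : Type := Fin d → Set.Icc (-1 : ℝ) 1

/-- A randomized mechanism on databases, with outputs in `R`: each database is mapped to the
probability distribution of the output. -/
abbrev Mechanism (n d : ℕ) (R : Type*) [MeasurableSpace R] : Type _ :=
  Database n d → ProbabilityMeasure R

/-- Two databases are adjacent if they agree outside a single row. -/
def Adjacent {n d : ℕ} (D D' : Database n d) : Prop :=
  ∃ i : Fin n, ∀ i' : Fin n, i' ≠ i → D i' = D' i'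

/-- `(ε, δ)`-differential privacy. -/
def IsDifferentiallyPrivate {n d : ℕ} {R : Type*} [MeasurableSpace R]
    (M : Mechanism n d R) (ε δ : ℝ) : Prop :=
  ∀ D D' : Database n d, Adjacent D D' → ∀ S : Set R, MeasurableSet S →
    (M D : Measure R).real S ≤ Real.exp ε * (M D' : Measure R).real S + δ

/-- The one-way marginals: the mean of each column. -/
noncomputable def oneWayMarginal {n d : ℕ} (D : Database n d) (j : Fin d) : ℝ :=
  (1 / (n : ℝ)) * ∑ i : Fin n, ((D i j : ℤ) : ℝ)

/-- The expected `L₁` error of `M` on the database `D` (the integrand is continuous and bounded). -/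
noncomputable def expectedL1Error {n d : ℕ} (M : Mechanism n d (Cube d)) (D : Database n d) : ℝ :=
  ∫ y : Cube d, ∑ j : Fin d, |(y j : ℝ) - oneWayMarginal D j| ∂(M D : Measure (Cube d))

/-! The argument is a fingerprinting argument combined with group privacy. Draw a database of `m`
rows with independent columns, each having i.i.d. entries with a common mean uniform on [-1,1]. With
the mean integrated out, a column has weight s!(m-s)!, and Laplace's rule of succession gives the
conditional mean of an entry given the others. The score of a row against an answer is the inner
product of the answer with the row centred at these conditional means.

Completeness: the scores add up to 2m/(m+1) times the inner product of the answer with the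
marginals. A marginal has second moment at least 1/3, so an answer with error at most d/4 has
expected total score at least d/12 (`le_sum_databaseWeight_mul_integral_score`). Soundness: if a row
is replaced by a fixed one, the answer no longer depends on it, and its score is subgaussian with
variance proxy of order d; privacy transfers the tail bound to the true answer
(`sum_databaseWeight_mul_measure_score_le`). Comparison gives 1/32 ≤ m(exp(ε - d/(9216m²)) + δ),
which is `fingerprinting_inequality`.

Now let L = log(1/δ). Repeating each of `m` rows `k` times costs a factor `k` in ε but allows mk of
order αn only. With k of order L/ε, group privacy still leaves the δ-term negligible, and the
inequality forces d ≲ m²L. Since mL is of order εαn, this is dL ≲ (εαn)². The first claim is the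
case ε = 1, α = 1/10 of the second. -/

/-- The real number `±1` underlying a sign. -/
def signVal (u : ℤˣ) : ℝ := ((u : ℤ) : ℝ)

@[simp] lemma signVal_one : signVal 1 = 1 := by simp [signVal]

@[simp] lemma signVal_neg (u : ℤˣ) : signVal (-u) = -signVal u := by simp [signVal]

lemma signVal_mul_self (u : ℤˣ) : signVal u * signVal u = 1 := by
  rcases Int.units_eq_one_or u with rfl | rfl <;> simp

lemma abs_signVal (u : ℤˣ) : |signVal u| = 1 := by
  rcases Int.units_eq_one_or u with rfl | rfl <;> simp

/-- The sum over `ℤˣ` has two terms. -/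
lemma sum_units_int (g : ℤˣ → ℝ) : ∑ u : ℤˣ, g u = g 1 + g (-1) := by
  rw [show (Finset.univ : Finset ℤˣ) = {1, -1} from rfl]
  exact Finset.sum_pair (by decide)

/-! ### The law of one column. -/

section Column

variable {m : ℕ}

/-- The number of entries `1` of a column. -/
def countOnes (x : Fin m → ℤˣ) : ℕ := ∑ i, if x i = 1 then 1 else 0

/-- The weight of a column with `s` entries `1`: up to normalization, the probability of the column
when its entries are drawn independently with a common, uniformly random mean. -/
def columnWeight (x : Fin m → ℤˣ) : ℝ :=
  ((countOnes x).factorial : ℝ) * ((m - countOnes x).factorial : ℝ)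

/-- The conditional mean of the `i`-th entry of a column given the other entries. -/
noncomputable def predictedMean (x : Fin m → ℤˣ) (i : Fin m) : ℝ :=
  (∑ i', signVal (x i') - signVal (x i)) / (m + 1)

lemma columnWeight_pos (x : Fin m → ℤˣ) : 0 < columnWeight x := by
  unfold columnWeight; positivity

lemma sum_update_column {A : Type*} [AddCommGroup A] (x : Fin m → ℤˣ) (i : Fin m) (b : ℤˣ)
    (g : ℤˣ → A) :
    ∑ i', g (Function.update x i b i') = ∑ i', g (x i') - g (x i) + g b := by
  rw [← Finset.add_sum_erase _ _ (Finset.mem_univ i),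
    ← Finset.add_sum_erase _ (fun i' => g (x i')) (Finset.mem_univ i),
    Finset.sum_congr rfl (g := fun i' => g (x i'))]
  · simp only [Function.update_self]; abel
  · intro i' hi'
    rw [Function.update_of_ne (Finset.ne_of_mem_erase hi')]

lemma predictedMean_update (x : Fin m → ℤˣ) (i : Fin m) (b : ℤˣ) :
    predictedMean (Function.update x i b) i = predictedMean x i := by
  unfold predictedMean
  rw [sum_update_column x i b signVal, Function.update_self]
  ring

lemma countOnes_le (x : Fin m → ℤˣ) : countOnes x ≤ m := by
  unfold countOnes
  calc _ ≤ ∑ _i : Fin m, 1 := Finset.sum_le_sum fun i _ => by split_ifs <;> simp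
    _ = m := by simp

lemma sum_signVal_eq (x : Fin m → ℤˣ) : ∑ i, signVal (x i) = 2 * countOnes x - m := by
  have h : ∀ i, signVal (x i) = 2 * (if x i = 1 then 1 else 0) - 1 := fun i => by
    rcases Int.units_eq_one_or (x i) with h | h <;> rw [h] <;> simp
    norm_num
  simp_rw [h, Finset.sum_sub_distrib, ← Finset.mul_sum]
  simp [countOnes]

lemma countOnes_update_one (x : Fin m → ℤˣ) (i : Fin m) :
    countOnes (Function.update x i 1) = countOnes (Function.update x i (-1)) + 1 := by
  have h1 := sum_signVal_eq (Function.update x i 1)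
  have h2 := sum_signVal_eq (Function.update x i (-1))
  rw [sum_update_column x i _ signVal] at h1 h2
  simp only [signVal_one, signVal_neg] at h1 h2
  have : (countOnes (Function.update x i 1) : ℝ) = countOnes (Function.update x i (-1)) + 1 := by
    linarith
  exact_mod_cast this

/-- This identity is what makes `predictedMean` the conditional mean: given the other entries, the
centred entry averages to zero. -/
lemma columnWeight_balance (x : Fin m → ℤˣ) (i : Fin m) :
    columnWeight (Function.update x i 1) * (1 - predictedMean x i) =
      columnWeight (Function.update x i (-1)) * (1 + predictedMean x i) := by
  have hc := countOnes_update_one x i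
  have hle := countOnes_le (Function.update x i 1)
  have hs := sum_signVal_eq (Function.update x i (-1))
  rw [sum_update_column x i _ signVal] at hs
  simp only [signVal_one, signVal_neg] at hs
  unfold predictedMean columnWeight
  rw [hc]
  set s := countOnes (Function.update x i (-1)) with hsdef
  obtain ⟨q, hq⟩ : ∃ q, m = s + 1 + q := ⟨m - (s + 1), by omega⟩
  have e1 : m - (s + 1) = q := by omega
  have e2 : m - s = q + 1 := by omega
  rw [e1, e2, Nat.factorial_succ, Nat.factorial_succ]
  have hm : (m : ℝ) = s + 1 + q := by exact_mod_cast hq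
  have hA : ∑ i', signVal (x i') - signVal (x i) = s - q := by rw [hm] at hs; linarith
  rw [hA, hm]
  have : (s : ℝ) + 1 + q + 1 ≠ 0 := by positivity
  push_cast
  field_simp
  ring

lemma abs_predictedMean_le (x : Fin m → ℤˣ) (i : Fin m) : |predictedMean x i| ≤ 1 := by
  unfold predictedMean
  have hm : (0 : ℝ) < m + 1 := by positivity
  rw [abs_div, abs_of_pos hm, div_le_one hm]
  calc _ ≤ |∑ i', signVal (x i')| + |signVal (x i)| := abs_sub _ _
    _ ≤ ∑ i', |signVal (x i')| + 1 := by
      rw [abs_signVal]; gcongr; exact Finset.abs_sum_le_sum_abs _ _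
    _ = m + 1 := by simp [abs_signVal]

lemma columnWeight_flip (x : Fin m → ℤˣ) (i : Fin m) :
    columnWeight (Function.update x i (-x i)) * (-signVal (x i) - predictedMean x i) =
      -(columnWeight x * (signVal (x i) - predictedMean x i)) := by
  have h := columnWeight_balance x i
  rcases Int.units_eq_one_or (x i) with hx | hx
  · have hu : Function.update x i 1 = x := by rw [← hx, Function.update_eq_self]
    rw [hu] at h
    rw [hx, signVal_one]; linarith
  · have hu : Function.update x i (-1) = x := by rw [← hx, Function.update_eq_self]
    rw [hu] at h
    rw [hx, neg_neg, signVal_neg, signVal_one]; linarith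

lemma sum_sub_predictedMean (x : Fin m → ℤˣ) :
    ∑ i, (signVal (x i) - predictedMean x i) = 2 / (m + 1) * ∑ i, signVal (x i) := by
  unfold predictedMean
  have hm : (m : ℝ) + 1 ≠ 0 := by positivity
  rw [Finset.sum_sub_distrib, ← Finset.sum_div, Finset.sum_sub_distrib]
  simp only [Finset.sum_const, Finset.card_univ, Fintype.card_fin, nsmul_eq_mul]
  field_simp
  ring

/-- The exponential moment of a centred sign. -/
lemma sum_columnWeight_mul_exp_le (x : Fin m → ℤˣ) (i : Fin m) {s : ℝ} (hs : |s| ≤ 1 / 2) :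
    ∑ b : ℤˣ, columnWeight (Function.update x i b) *
        Real.exp (s * (signVal b - predictedMean x i)) ≤
      Real.exp (s ^ 2) * ∑ b : ℤˣ, columnWeight (Function.update x i b) := by
  have hbal := columnWeight_balance x i
  have hμ := abs_le.1 (abs_predictedMean_le x i)
  have hp := columnWeight_pos (Function.update x i 1)
  have hq := columnWeight_pos (Function.update x i (-1))
  rw [sum_units_int, sum_units_int, signVal_neg, signVal_one]
  set μ := predictedMean x i
  set p := columnWeight (Function.update x i 1)
  set q := columnWeight (Function.update x i (-1))
  -- A centred sign is at most 2 in absolute value, so |s| ≤ 1/2 permits exp u ≤ 1 + u + u². The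
  -- linear terms cancel by balance and the variance is 1 - μ² ≤ 1.
  have key : ∀ v : ℝ, |v| ≤ 2 → Real.exp (s * v) ≤ 1 + s * v + (s * v) ^ 2 := fun v hv => by
    have hsv : |s * v| ≤ 1 := by
      rw [abs_mul]; nlinarith [abs_nonneg s, abs_nonneg v]
    have := (abs_le.1 (Real.abs_exp_sub_one_sub_id_le hsv)).2
    linarith
  have h1 := key (1 - μ) (abs_le.2 ⟨by linarith, by linarith⟩)
  have h2 := key (-1 - μ) (abs_le.2 ⟨by linarith, by linarith⟩)
  have hvar : p * (1 - μ) ^ 2 + q * (-1 - μ) ^ 2 ≤ p + q := by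
    have : p * (1 - μ) ^ 2 + q * (-1 - μ) ^ 2 = (1 - μ ^ 2) * (p + q) := by
      linear_combination 2 * (-μ) * hbal
    rw [this]
    nlinarith [sq_nonneg μ]
  have he := Real.add_one_le_exp (s ^ 2)
  calc _ ≤ p * (1 + s * (1 - μ) + (s * (1 - μ)) ^ 2) +
        q * (1 + s * (-1 - μ) + (s * (-1 - μ)) ^ 2) := by gcongr
    _ = (p + q) + s ^ 2 * (p * (1 - μ) ^ 2 + q * (-1 - μ) ^ 2) := by
      linear_combination s * hbal
    _ ≤ (p + q) + s ^ 2 * (p + q) := by gcongr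
    _ = (s ^ 2 + 1) * (p + q) := by ring
    _ ≤ _ := by gcongr

end Column

/-! ### Random databases with independent columns, and row scores. -/

section Weight

variable {m d : ℕ}

/-- The `j`-th column of a database. -/
def column (X : Database m d) (j : Fin d) : Fin m → ℤˣ := fun i => X i j

/-- The weight of a database whose columns are drawn independently. -/
def databaseWeight (X : Database m d) : ℝ := ∏ j, columnWeight (column X j)

lemma databaseWeight_pos (X : Database m d) : 0 < databaseWeight X :=
  Finset.prod_pos fun _ _ => columnWeight_pos _

lemma column_update (X : Database m d) (i : Fin m) (a : Fin d → ℤˣ) (j : Fin d) :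
    column (Function.update X i a) j = Function.update (column X j) i (a j) := by
  ext i'
  rcases eq_or_ne i' i with rfl | h
  · simp [column]
  · simp [column, h]

/-- The database with the sign of the entry `(i, j)` changed. -/
def flipEntry (i : Fin m) (j : Fin d) (X : Database m d) : Database m d :=
  Function.update X i (Function.update (X i) j (-X i j))

lemma flipEntry_apply_self (i : Fin m) (j : Fin d) (X : Database m d) :
    flipEntry i j X i j = -X i j := by simp [flipEntry]

lemma flipEntry_involutive (i : Fin m) (j : Fin d) :
    Function.Involutive (flipEntry i j : Database m d → Database m d) := fun X => by
  simp [flipEntry]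

lemma column_flipEntry_self (i : Fin m) (j : Fin d) (X : Database m d) :
    column (flipEntry i j X) j = Function.update (column X j) i (-column X j i) := by
  rw [flipEntry, column_update, Function.update_self]; rfl

lemma column_flipEntry_of_ne (i : Fin m) {j j' : Fin d} (h : j' ≠ j) (X : Database m d) :
    column (flipEntry i j X) j' = column X j' := by
  rw [flipEntry, column_update, Function.update_of_ne h]
  exact Function.update_eq_self i (column X j')

/-- The centred entries of a random database are uncorrelated with every function of the other
entries. -/
lemma sum_databaseWeight_mul_centred (i : Fin m) (j : Fin d) (F : Database m d → ℝ)
    (hF : ∀ X, F (flipEntry i j X) = F X) :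
    ∑ X : Database m d, databaseWeight X *
      (signVal (X i j) - predictedMean (column X j) i) * F X = 0 := by
  have key : ∀ X : Database m d, databaseWeight (flipEntry i j X) *
      (signVal (flipEntry i j X i j) - predictedMean (column (flipEntry i j X) j) i) *
        F (flipEntry i j X) =
      -(databaseWeight X * (signVal (X i j) - predictedMean (column X j) i) * F X) := fun X => by
    have h := columnWeight_flip (column X j) i
    unfold databaseWeight
    rw [hF, flipEntry_apply_self, signVal_neg, ← Finset.mul_prod_erase _ _ (Finset.mem_univ j),
      ← Finset.mul_prod_erase _ (fun j' => columnWeight (column X j')) (Finset.mem_univ j),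
      Finset.prod_congr rfl fun j' hj' => by
        rw [column_flipEntry_of_ne i (Finset.ne_of_mem_erase hj') X],
      column_flipEntry_self, predictedMean_update]
    change columnWeight _ * _ * (-signVal (column X j i) - _) * _ =
      -(_ * _ * (signVal (column X j i) - _) * _)
    linear_combination (∏ j' ∈ Finset.univ.erase j, columnWeight (column X j')) * F X * h
  have h := Equiv.sum_comp (flipEntry_involutive i j).toPerm fun X : Database m d =>
    databaseWeight X * (signVal (X i j) - predictedMean (column X j) i) * F X
  simp only [Function.Involutive.coe_toPerm, key, Finset.sum_neg_distrib] at h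
  linarith

/-- The second moment of a column sum. -/
lemma sum_databaseWeight_mul_columnSum_sq (j : Fin d) :
    3 * ∑ X : Database m d, databaseWeight X * (∑ i, signVal (X i j)) ^ 2 =
      m * (m + 2) * ∑ X : Database m d, databaseWeight X := by
  -- Take as test function the sum of the other entries of the column. Summed over `i`, the
  -- orthogonality relation becomes linear in the squared column sum.
  have h0 : ∑ X : Database m d, ∑ i, databaseWeight X *
      (signVal (X i j) - predictedMean (column X j) i) *
        (∑ i', signVal (X i' j) - signVal (X i j)) = 0 := by
    rw [Finset.sum_comm]
    refine Finset.sum_eq_zero fun i _ => sum_databaseWeight_mul_centred i j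
      (fun X => ∑ i', signVal (X i' j) - signVal (X i j)) fun X => ?_
    have h := sum_update_column (column X j) i (-column X j i) signVal
    rw [← column_flipEntry_self] at h
    change ∑ i', signVal (column (flipEntry i j X) j i') - signVal (flipEntry i j X i j) = _
    rw [h, flipEntry_apply_self]
    simp only [column]
    ring
  have hm : (m : ℝ) + 1 ≠ 0 := by positivity
  have h1 : ∀ X : Database m d, ∑ i, databaseWeight X *
      (signVal (X i j) - predictedMean (column X j) i) *
        (∑ i', signVal (X i' j) - signVal (X i j)) =
      (3 * (databaseWeight X * (∑ i, signVal (X i j)) ^ 2) - m * (m + 2) * databaseWeight X) /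
        (m + 1) := fun X => by
    set S := ∑ i', signVal (X i' j) with hS
    have h2 : ∀ i, databaseWeight X * (signVal (X i j) - predictedMean (column X j) i) *
        (S - signVal (X i j)) = databaseWeight X / (m + 1) *
          ((m + 3) * S * signVal (X i j) - (m + 2) - S ^ 2) := fun i => by
      have e : predictedMean (column X j) i = (S - signVal (X i j)) / (m + 1) := rfl
      rw [e]
      field_simp
      linear_combination (-(databaseWeight X) * (m + 2)) * signVal_mul_self (X i j)
    simp_rw [h2]
    rw [← Finset.mul_sum, Finset.sum_sub_distrib, Finset.sum_sub_distrib, ← Finset.mul_sum, ← hS]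
    simp only [Finset.sum_const, Finset.card_univ, Fintype.card_fin, nsmul_eq_mul]
    field_simp
    ring
  simp_rw [h1] at h0
  rw [← Finset.sum_div, div_eq_zero_iff, or_iff_left hm, Finset.sum_sub_distrib,
    ← Finset.mul_sum, ← Finset.mul_sum] at h0
  linarith

/-- Resampling a row uniformly does not change the uniform sum over databases. -/
lemma sum_sum_update (i : Fin m) (G : Database m d → ℝ) :
    ∑ X : Database m d, ∑ a : Fin d → ℤˣ, G (Function.update X i a) =
      Fintype.card (Fin d → ℤˣ) * ∑ X : Database m d, G X := by
  have hinv : Function.Involutive (fun q : Database m d × (Fin d → ℤˣ) =>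
      ((Function.update q.1 i q.2, q.1 i) : Database m d × (Fin d → ℤˣ))) := fun q => by
    simp
  have h := Equiv.sum_comp hinv.toPerm fun q : Database m d × (Fin d → ℤˣ) => G q.1
  simp only [Function.Involutive.coe_toPerm] at h
  rw [Fintype.sum_prod_type, Fintype.sum_prod_type] at h
  rw [h]
  simp [Finset.mul_sum]

/-- Allows conditioning on all rows but the `i`-th: it suffices to compare sums over that row alone.
-/
lemma sum_le_of_sum_update_le (i : Fin m) (G H : Database m d → ℝ)
    (h : ∀ X, ∑ a, G (Function.update X i a) ≤ ∑ a, H (Function.update X i a)) :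
    ∑ X, G X ≤ ∑ X, H X := by
  have := Finset.sum_le_sum fun X (_ : X ∈ (Finset.univ : Finset (Database m d))) => h X
  rw [sum_sum_update, sum_sum_update] at this
  exact le_of_mul_le_mul_left this (by exact_mod_cast Fintype.card_pos)

/-- The fingerprinting score of the `i`-th row of `X` against the answer `v`. -/
noncomputable def score (v : Fin d → ℝ) (X : Database m d) (i : Fin m) : ℝ :=
  ∑ j, v j * (signVal (X i j) - predictedMean (column X j) i)

lemma abs_score_le {v : Fin d → ℝ} (hv : ∀ j, |v j| ≤ 1) (X : Database m d) (i : Fin m) :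
    |score v X i| ≤ 2 * d := by
  unfold score
  calc _ ≤ ∑ j, |v j * (signVal (X i j) - predictedMean (column X j) i)| :=
        Finset.abs_sum_le_sum_abs _ _
    _ ≤ ∑ _j : Fin d, 2 := Finset.sum_le_sum fun j _ => by
      rw [abs_mul]
      have h1 := abs_sub (signVal (X i j)) (predictedMean (column X j) i)
      rw [abs_signVal] at h1
      nlinarith [hv j, abs_predictedMean_le (column X j) i, abs_nonneg (v j),
        abs_nonneg (signVal (X i j) - predictedMean (column X j) i)]
    _ = 2 * d := by simp [mul_comm]

lemma sum_score (v : Fin d → ℝ) (X : Database m d) :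
    ∑ i, score v X i = 2 / (m + 1) * ∑ j, v j * ∑ i, signVal (X i j) := by
  unfold score
  rw [Finset.sum_comm, Finset.mul_sum]
  refine Finset.sum_congr rfl fun j _ => ?_
  rw [← Finset.mul_sum]
  have := sum_sub_predictedMean (column X j)
  simp only [column] at this ⊢
  rw [this]; ring

/-- The exponential moment of the score of a row that the answer does not depend on. -/
lemma sum_update_databaseWeight_mul_exp_score_le {v : Fin d → ℝ} (hv : ∀ j, |v j| ≤ 1)
    (X : Database m d) (i : Fin m) {t : ℝ} (ht0 : 0 ≤ t) (ht : t ≤ 1 / 2) :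
    ∑ a : Fin d → ℤˣ, databaseWeight (Function.update X i a) *
        Real.exp (t * score v (Function.update X i a) i) ≤
      Real.exp (t ^ 2 * d) * ∑ a : Fin d → ℤˣ, databaseWeight (Function.update X i a) := by
  have htv : ∀ j, |t * v j| ≤ t := fun j => by
    rw [abs_mul, abs_of_nonneg ht0]; nlinarith [hv j]
  have e1 : ∀ a : Fin d → ℤˣ, databaseWeight (Function.update X i a) *
      Real.exp (t * score v (Function.update X i a) i) =
      ∏ j, columnWeight (Function.update (column X j) i (a j)) *
        Real.exp (t * v j * (signVal (a j) - predictedMean (column X j) i)) := fun a => by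
    simp only [databaseWeight, score, column_update, predictedMean_update, Function.update_self]
    rw [Finset.mul_sum, Real.exp_sum, ← Finset.prod_mul_distrib]
    simp only [mul_assoc]
  have e2 : ∀ a : Fin d → ℤˣ, databaseWeight (Function.update X i a) =
      ∏ j, columnWeight (Function.update (column X j) i (a j)) := fun a => by
    simp only [databaseWeight, column_update]
  simp_rw [e1, e2]
  rw [← Fintype.prod_sum (fun j b => columnWeight (Function.update (column X j) i b) *
        Real.exp (t * v j * (signVal b - predictedMean (column X j) i))),
    ← Fintype.prod_sum (fun j b => columnWeight (Function.update (column X j) i b))]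
  calc _ ≤ ∏ j, Real.exp (t ^ 2) * ∑ b, columnWeight (Function.update (column X j) i b) := by
        refine Finset.prod_le_prod (fun j _ => Finset.sum_nonneg fun b _ =>
          mul_nonneg (columnWeight_pos _).le (Real.exp_pos _).le) fun j _ => ?_
        refine (sum_columnWeight_mul_exp_le _ _ ((htv j).trans ht)).trans ?_
        refine mul_le_mul_of_nonneg_right (Real.exp_le_exp.2 ?_)
          (Finset.sum_nonneg fun b _ => (columnWeight_pos _).le)
        exact sq_le_sq' (by linarith [(abs_le.1 (htv j)).1]) (abs_le.1 (htv j)).2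
    _ = _ := by
        rw [Finset.prod_mul_distrib, Finset.prod_const, ← Real.exp_nat_mul]
        simp [mul_comm]

end Weight

/-! ### Soundness and completeness of the scores. -/

section Fingerprinting

variable {m d : ℕ} {Ω : Type*} [MeasurableSpace Ω]

lemma abs_oneWayMarginal_le (hm : 0 < m) (X : Database m d) (j : Fin d) :
    |oneWayMarginal X j| ≤ 1 := by
  have hm1 : (0 : ℝ) < m := by exact_mod_cast hm
  unfold oneWayMarginal
  rw [abs_mul, abs_of_nonneg (by positivity), one_div, inv_mul_le_iff₀ hm1, mul_one]
  calc _ ≤ ∑ i, |signVal (X i j)| := Finset.abs_sum_le_sum_abs _ _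
    _ = m := by simp [abs_signVal]

lemma measurable_score {f : Ω → Fin d → ℝ} (hf : ∀ j, Measurable fun ω => f ω j)
    (X : Database m d) (i : Fin m) : Measurable fun ω => score (f ω) X i :=
  Finset.measurable_sum _ fun j _ => (hf j).mul_const _

lemma integrable_score (μ : Measure Ω) [IsFiniteMeasure μ] {f : Ω → Fin d → ℝ}
    (hf : ∀ j, Measurable fun ω => f ω j) (hb : ∀ ω j, |f ω j| ≤ 1)
    (X : Database m d) (i : Fin m) : Integrable (fun ω => score (f ω) X i) μ :=
  Integrable.of_bound (measurable_score hf X i).aestronglyMeasurable (2 * d)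
    (ae_of_all _ fun ω => abs_score_le (hb ω) X i)

lemma integrable_exp_score (μ : Measure Ω) [IsFiniteMeasure μ] {f : Ω → Fin d → ℝ}
    (hf : ∀ j, Measurable fun ω => f ω j) (hb : ∀ ω j, |f ω j| ≤ 1)
    (X : Database m d) (i : Fin m) {t : ℝ} (ht : 0 ≤ t) :
    Integrable (fun ω => Real.exp (t * score (f ω) X i)) μ := by
  refine Integrable.of_bound
    (((measurable_score hf X i).const_mul t).exp).aestronglyMeasurable (Real.exp (t * (2 * d)))
    (ae_of_all _ fun ω => ?_)
  rw [Real.norm_eq_abs, Real.abs_exp]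
  gcongr
  exact (abs_le.1 (abs_score_le (hb ω) X i)).2

/-- Soundness: under differential privacy, the score of a row is rarely large. -/
lemma sum_databaseWeight_mul_measure_score_le (P : Mechanism m d Ω) {ε δ : ℝ}
    (hP : IsDifferentiallyPrivate P ε δ) {f : Ω → Fin d → ℝ}
    (hf : ∀ j, Measurable fun ω => f ω j) (hb : ∀ ω j, |f ω j| ≤ 1) (i : Fin m)
    {t : ℝ} (ht0 : 0 ≤ t) (ht : t ≤ 1 / 2) (l : ℝ) :
    ∑ X, databaseWeight X * (P X : Measure Ω).real {ω | l ≤ score (f ω) X i} ≤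
      (Real.exp ε * Real.exp (t ^ 2 * d - t * l) + δ) * ∑ X : Database m d, databaseWeight X := by
  set a₀ : Fin d → ℤˣ := 1
  have h1 : ∀ X, (P X : Measure Ω).real {ω | l ≤ score (f ω) X i} ≤
      Real.exp ε * (Real.exp (-t * l) *
        ∫ ω, Real.exp (t * score (f ω) X i) ∂(P (Function.update X i a₀) : Measure Ω)) + δ :=
    fun X => by
    refine (hP X (Function.update X i a₀) ⟨i, fun i' hi' => ?_⟩ _
      (measurableSet_le measurable_const (measurable_score hf X i))).trans ?_
    · rw [Function.update_of_ne hi']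
    · gcongr
      exact ProbabilityTheory.measure_ge_le_exp_mul_mgf l ht0
        (integrable_exp_score _ hf hb X i ht0)
  have h2 : ∑ X, databaseWeight X *
      ∫ ω, Real.exp (t * score (f ω) X i) ∂(P (Function.update X i a₀) : Measure Ω) ≤
      ∑ X : Database m d, Real.exp (t ^ 2 * d) * databaseWeight X := by
    refine sum_le_of_sum_update_le i _ _ fun X => ?_
    -- Resetting row `i` to `a₀` erases the resampled row `a`, so the output law is the same for all
    -- `a` and the sum moves inside one integral.
    simp only [Function.update_idem]
    rw [← Finset.mul_sum]
    simp_rw [← integral_const_mul]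
    rw [← integral_finsetSum _ fun a _ => (integrable_exp_score _ hf hb _ i ht0).const_mul _]
    calc _ ≤ ∫ _ω, Real.exp (t ^ 2 * d) * ∑ a : Fin d → ℤˣ,
          databaseWeight (Function.update X i a) ∂(P (Function.update X i a₀) : Measure Ω) := by
          refine integral_mono (integrable_finsetSum _ fun a _ =>
            (integrable_exp_score _ hf hb _ i ht0).const_mul _) (integrable_const _) fun ω => ?_
          exact sum_update_databaseWeight_mul_exp_score_le (hb ω) X i ht0 ht
      _ = _ := by simp
  have hexp : Real.exp (t ^ 2 * d - t * l) = Real.exp (-t * l) * Real.exp (t ^ 2 * d) := by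
    rw [← Real.exp_add]; ring_nf
  calc _ ≤ ∑ X, databaseWeight X * (Real.exp ε * (Real.exp (-t * l) *
        ∫ ω, Real.exp (t * score (f ω) X i) ∂(P (Function.update X i a₀) : Measure Ω)) + δ) :=
        Finset.sum_le_sum fun X _ => mul_le_mul_of_nonneg_left (h1 X) (databaseWeight_pos X).le
    _ = Real.exp ε * Real.exp (-t * l) * (∑ X, databaseWeight X *
        ∫ ω, Real.exp (t * score (f ω) X i) ∂(P (Function.update X i a₀) : Measure Ω)) +
        δ * ∑ X : Database m d, databaseWeight X := by
      rw [Finset.mul_sum, Finset.mul_sum, ← Finset.sum_add_distrib]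
      exact Finset.sum_congr rfl fun X _ => by ring
    _ ≤ Real.exp ε * Real.exp (-t * l) * (∑ X : Database m d,
        Real.exp (t ^ 2 * d) * databaseWeight X) +
        δ * ∑ X : Database m d, databaseWeight X := by gcongr
    _ = _ := by rw [hexp, ← Finset.mul_sum]; ring

/-- Below the threshold the score is at most `l`; above it the trivial bound `2 * d` applies. -/
lemma integral_score_le (μ : Measure Ω) [IsProbabilityMeasure μ] {f : Ω → Fin d → ℝ}
    (hf : ∀ j, Measurable fun ω => f ω j) (hb : ∀ ω j, |f ω j| ≤ 1)
    (X : Database m d) (i : Fin m) {l : ℝ} (hl : 0 ≤ l) :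
    ∫ ω, score (f ω) X i ∂μ ≤ l + 2 * d * μ.real {ω | l ≤ score (f ω) X i} := by
  have hS : MeasurableSet {ω | l ≤ score (f ω) X i} :=
    measurableSet_le measurable_const (measurable_score hf X i)
  have hint : Integrable ({ω | l ≤ score (f ω) X i}.indicator fun _ => (2 * d : ℝ)) μ :=
    (integrable_const _).indicator hS
  calc _ ≤ ∫ ω, (l + {ω | l ≤ score (f ω) X i}.indicator (fun _ => (2 * d : ℝ)) ω) ∂μ := by
        refine integral_mono (integrable_score μ hf hb X i) ((integrable_const _).add hint)
          fun ω => ?_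
        have h := (abs_le.1 (abs_score_le (hb ω) X i)).2
        by_cases hω : l ≤ score (f ω) X i
        · have : ω ∈ {ω | l ≤ score (f ω) X i} := hω
          simp only [Set.indicator_of_mem this]; linarith
        · have : ω ∉ {ω | l ≤ score (f ω) X i} := hω
          simp only [Set.indicator_of_notMem this]; linarith
    _ = _ := by
      rw [integral_add (integrable_const _) hint, integral_indicator_const _ hS]
      simp [mul_comm]

/-- Completeness: the scores against an accurate answer add up to a large number. -/
lemma le_sum_databaseWeight_mul_integral_score (hm : 0 < m) (P : Mechanism m d Ω)
    {f : Ω → Fin d → ℝ} (hf : ∀ j, Measurable fun ω => f ω j) (hb : ∀ ω j, |f ω j| ≤ 1)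
    (hacc : ∀ X, ∫ ω, ∑ j, |f ω j - oneWayMarginal X j| ∂(P X : Measure Ω) ≤ d / 4) :
    (d / 12 : ℝ) * ∑ X : Database m d, databaseWeight X ≤
      ∑ X, databaseWeight X * ∑ i, ∫ ω, score (f ω) X i ∂(P X : Measure Ω) := by
  have hm1 : (1 : ℝ) ≤ m := by exact_mod_cast hm
  set q : ℝ := 2 * m / (m + 1) with hq
  have hq1 : 1 ≤ q := by rw [hq, le_div_iff₀ (by positivity)]; linarith
  have hmarg : ∀ (X : Database m d) j, ∑ i, signVal (X i j) = m * oneWayMarginal X j :=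
    fun X j => by
    unfold oneWayMarginal
    change ∑ i, signVal (X i j) = m * (1 / m * ∑ i, signVal (X i j))
    field_simp
  -- Writing p for the marginal and f for the answer, fp = p² + (f - p)p ≥ p² - |f - p| because |p|
  -- ≤ 1.
  have hpt : ∀ (X : Database m d) ω, q * (∑ j, oneWayMarginal X j ^ 2 -
      ∑ j, |f ω j - oneWayMarginal X j|) ≤ ∑ i, score (f ω) X i := fun X ω => by
    rw [sum_score, ← Finset.sum_sub_distrib]
    have : 2 / ((m : ℝ) + 1) * ∑ j, f ω j * ∑ i, signVal (X i j) =
        q * ∑ j, f ω j * oneWayMarginal X j := by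
      rw [hq, Finset.mul_sum, Finset.mul_sum]
      refine Finset.sum_congr rfl fun j _ => ?_
      rw [hmarg]; ring
    rw [this]
    gcongr with j
    have h1 := abs_mul (f ω j - oneWayMarginal X j) (oneWayMarginal X j)
    have h2 := neg_abs_le ((f ω j - oneWayMarginal X j) * oneWayMarginal X j)
    nlinarith [abs_oneWayMarginal_le hm X j, abs_nonneg (f ω j - oneWayMarginal X j)]
  have hint : ∀ X, Integrable (fun ω => ∑ j, |f ω j - oneWayMarginal X j|) (P X : Measure Ω) :=
    fun X => integrable_finsetSum _ fun j _ =>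
      ((Integrable.of_bound (hf j).aestronglyMeasurable 1 (ae_of_all _ fun ω => hb ω j)).sub
        (integrable_const _)).abs
  have hX : ∀ X, q * (∑ j, oneWayMarginal X j ^ 2 - d / 4) ≤
      ∑ i, ∫ ω, score (f ω) X i ∂(P X : Measure Ω) := fun X => by
    rw [← integral_finsetSum _ fun i _ => integrable_score _ hf hb X i]
    calc _ ≤ q * (∑ j, oneWayMarginal X j ^ 2 -
          ∫ ω, ∑ j, |f ω j - oneWayMarginal X j| ∂(P X : Measure Ω)) := by
          gcongr; exact hacc X
      _ = ∫ ω, q * (∑ j, oneWayMarginal X j ^ 2 -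
          ∑ j, |f ω j - oneWayMarginal X j|) ∂(P X : Measure Ω) := by
          rw [integral_const_mul, integral_sub (integrable_const _) (hint X)]; simp
      _ ≤ _ := integral_mono (((integrable_const _).sub (hint X)).const_mul _)
          (integrable_finsetSum _ fun i _ => integrable_score _ hf hb X i) (hpt X)
  set T := ∑ X : Database m d, databaseWeight X with hT
  have hT0 : 0 ≤ T := Finset.sum_nonneg fun X _ => (databaseWeight_pos X).le
  have hsq : ∀ j, T / 3 ≤ ∑ X : Database m d, databaseWeight X * oneWayMarginal X j ^ 2 :=
    fun j => by
    have h := sum_databaseWeight_mul_columnSum_sq (m := m) j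
    simp_rw [hmarg, mul_pow] at h
    have h' : ∑ X : Database m d, databaseWeight X * ((m : ℝ) ^ 2 * oneWayMarginal X j ^ 2) =
        (m : ℝ) ^ 2 * ∑ X : Database m d, databaseWeight X * oneWayMarginal X j ^ 2 := by
      rw [Finset.mul_sum]; exact Finset.sum_congr rfl fun X _ => by ring
    rw [h', ← hT] at h
    refine le_of_mul_le_mul_left (a := (m : ℝ) ^ 2) ?_ (by positivity)
    nlinarith [mul_nonneg (by positivity : (0 : ℝ) ≤ m) hT0]
  have hsum : d * (T / 3) ≤ ∑ X : Database m d,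
      databaseWeight X * ∑ j, oneWayMarginal X j ^ 2 := by
    simp_rw [Finset.mul_sum]
    rw [Finset.sum_comm]
    calc (d * (T / 3) : ℝ) = ∑ _j : Fin d, T / 3 := by simp
      _ ≤ _ := Finset.sum_le_sum fun j _ => hsq j
  calc (d / 12 : ℝ) * T ≤ q * (d / 12 * T) := le_mul_of_one_le_left (by positivity) hq1
    _ ≤ q * (∑ X : Database m d, databaseWeight X * ∑ j, oneWayMarginal X j ^ 2 - d / 4 * T) := by
      gcongr; linarith
    _ = ∑ X : Database m d, databaseWeight X * (q * (∑ j, oneWayMarginal X j ^ 2 - d / 4)) := by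
      rw [hT, Finset.mul_sum, ← Finset.sum_sub_distrib, Finset.mul_sum]
      exact Finset.sum_congr rfl fun X _ => by ring
    _ ≤ _ := Finset.sum_le_sum fun X _ => mul_le_mul_of_nonneg_left (hX X) (databaseWeight_pos X).le

/-- The fingerprinting inequality for private and accurate mechanisms. -/
theorem fingerprinting_inequality (hm : 0 < m) (hd : 0 < d) (P : Mechanism m d Ω) {ε δ : ℝ}
    (hP : IsDifferentiallyPrivate P ε δ) {f : Ω → Fin d → ℝ}
    (hf : ∀ j, Measurable fun ω => f ω j) (hb : ∀ ω j, |f ω j| ≤ 1)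
    (hacc : ∀ X, ∫ ω, ∑ j, |f ω j - oneWayMarginal X j| ∂(P X : Measure Ω) ≤ d / 4) :
    1 / 32 ≤ m * (Real.exp (ε - d / (9216 * m ^ 2)) + δ) := by
  have hm1 : (1 : ℝ) ≤ m := by exact_mod_cast hm
  have hd0 : (0 : ℝ) < d := by exact_mod_cast hd
  set T := ∑ X : Database m d, databaseWeight X with hT
  have hT0 : 0 < T := Finset.sum_pos (fun X _ => databaseWeight_pos X) Finset.univ_nonempty
  -- The `m` thresholds add up to d/48, a quarter of the total d/12. The value t = l/(2d) minimizes
  -- t²d - tl.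
  set l : ℝ := d / (48 * m) with hl
  set t : ℝ := 1 / (96 * m) with ht
  set E : ℝ := Real.exp (ε - d / (9216 * m ^ 2)) with hE
  have ht2 : t ≤ 1 / 2 := by rw [ht]; gcongr; linarith
  have hexp : Real.exp ε * Real.exp (t ^ 2 * d - t * l) = E := by
    rw [← Real.exp_add, hE, ht, hl]
    congr 1
    field_simp
    ring
  have h1 : ∀ i : Fin m, ∑ X, databaseWeight X * ∫ ω, score (f ω) X i ∂(P X : Measure Ω) ≤
      l * T + 2 * d * ((E + δ) * T) := fun i => by
    have h := sum_databaseWeight_mul_measure_score_le P hP hf hb i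
      (by positivity : 0 ≤ t) ht2 l
    rw [hexp, ← hT] at h
    calc _ ≤ ∑ X, databaseWeight X *
          (l + 2 * d * (P X : Measure Ω).real {ω | l ≤ score (f ω) X i}) :=
          Finset.sum_le_sum fun X _ => mul_le_mul_of_nonneg_left
            (integral_score_le _ hf hb X i (by positivity)) (databaseWeight_pos X).le
      _ = l * T + 2 * d * ∑ X, databaseWeight X *
          (P X : Measure Ω).real {ω | l ≤ score (f ω) X i} := by
          rw [hT, Finset.mul_sum, Finset.mul_sum, ← Finset.sum_add_distrib]
          exact Finset.sum_congr rfl fun X _ => by ring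
      _ ≤ _ := by gcongr
  have h2 := le_sum_databaseWeight_mul_integral_score hm P hf hb hacc
  simp_rw [Finset.mul_sum] at h2
  rw [Finset.sum_comm, ← Finset.mul_sum, ← hT] at h2
  have h3 := h2.trans (Finset.sum_le_sum fun i _ => h1 i)
  simp only [Finset.sum_const, Finset.card_univ, Fintype.card_fin, nsmul_eq_mul] at h3
  have hml : m * l = d / 48 := by rw [hl]; field_simp
  have h4 : (d * T) * (1 / 32) ≤ (d * T) * (m * (E + δ)) := by
    have : (m : ℝ) * (l * T + 2 * d * ((E + δ) * T)) =
        (m * l) * T + 2 * ((d * T) * (m * (E + δ))) := by ring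
    rw [this, hml] at h3
    linarith
  exact le_of_mul_le_mul_left h4 (by positivity)

end Fingerprinting

/-! ### Group privacy and repeated rows. -/

/-- Group privacy. -/
lemma IsDifferentiallyPrivate.group {n d : ℕ} {R : Type*} [MeasurableSpace R]
    {M : Mechanism n d R} {ε δ : ℝ} (hM : IsDifferentiallyPrivate M ε δ) (hε : 0 ≤ ε)
    (hδ : 0 ≤ δ) {S : Set R} (hS : MeasurableSet S) (s : Finset (Fin n)) :
    ∀ D D' : Database n d, (∀ i, i ∉ s → D i = D' i) →
      (M D : Measure R).real S ≤ Real.exp (s.card * ε) * (M D' : Measure R).real S +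
        s.card * Real.exp (s.card * ε) * δ := by
  induction s using Finset.induction_on with
  | empty =>
    intro D D' h
    have : D = D' := funext fun i => h i (Finset.notMem_empty i)
    simp [this]
  | insert i s hi ih =>
    intro D D' h
    have h1 := hM D (Function.update D i (D' i))
      ⟨i, fun i' hi' => by rw [Function.update_of_ne hi']⟩ S hS
    have h2 := ih (Function.update D i (D' i)) D' fun i' hi' => by
      rcases eq_or_ne i' i with rfl | hne
      · simp
      · rw [Function.update_of_ne hne]
        exact h i' (by simp [hne, hi'])
    rw [Finset.card_insert_of_notMem hi]
    push_cast
    rw [add_mul (s.card : ℝ) 1 ε, one_mul, Real.exp_add]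
    have he := Real.one_le_exp hε
    have he' : 1 ≤ Real.exp (s.card * ε) := Real.one_le_exp (by positivity)
    have h3 : 1 ≤ Real.exp (s.card * ε) * Real.exp ε := one_le_mul_of_one_le_of_one_le he' he
    calc _ ≤ Real.exp ε * (Real.exp (s.card * ε) * (M D' : Measure R).real S +
          s.card * Real.exp (s.card * ε) * δ) + 1 * δ := by
          rw [one_mul]; refine h1.trans ?_; gcongr
      _ ≤ Real.exp ε * (Real.exp (s.card * ε) * (M D' : Measure R).real S +
          s.card * Real.exp (s.card * ε) * δ) + Real.exp (s.card * ε) * Real.exp ε * δ := by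
          gcongr
      _ = _ := by ring

section Replication

variable {m d : ℕ}

/-- The database of size `n` in which each row of `X` occurs `k` times, filled up by rows that are
alternately constantly `1` and `-1`. -/
def replicateRows (n k : ℕ) (X : Database m d) : Database n d := fun r j =>
  if h : r.val / k < m then X ⟨r.val / k, h⟩ j else (-1) ^ r.val

lemma IsDifferentiallyPrivate.replicateRows {n k : ℕ} (hk : 0 < k) {R : Type*} [MeasurableSpace R]
    {M : Mechanism n d R} {ε δ : ℝ} (hM : IsDifferentiallyPrivate M ε δ) (hε : 0 ≤ ε)
    (hδ : 0 ≤ δ) :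
    IsDifferentiallyPrivate (fun X : Database m d => M (replicateRows n k X)) (k * ε)
      (k * Real.exp (k * ε) * δ) := by
  rintro X X' ⟨i, hi⟩ S hS
  set s : Finset (Fin n) := Finset.univ.filter fun r => r.val / k = i.val with hs
  have hcard : s.card ≤ k := by
    calc s.card ≤ (Finset.range k).card := by
          -- Positions in the same block are separated by their residues mod `k`.
          refine Finset.card_le_card_of_injOn (fun r => r.val % k)
            (fun r _ => by simpa using Nat.mod_lt _ hk) fun r hr r' hr' h => ?_
          simp only [hs, Finset.coe_filter, Finset.mem_univ, true_and, Set.mem_ofPred_eq] at hr hr'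
          have h' : r.val % k = r'.val % k := h
          rw [Fin.ext_iff, ← Nat.div_add_mod r.val k, ← Nat.div_add_mod r'.val k, hr, hr', h']
      _ = k := Finset.card_range k
  have hcard' : (s.card : ℝ) ≤ k := by exact_mod_cast hcard
  refine (hM.group hε hδ hS s (_root_.replicateRows n k X) (_root_.replicateRows n k X')
    fun r hr => ?_).trans (by gcongr)
  have hr' : r.val / k ≠ i.val := by simpa [hs] using hr
  funext j
  unfold _root_.replicateRows
  split_ifs with h
  · rw [hi ⟨r.val / k, h⟩ (by rwa [Ne, Fin.ext_iff])]
  · rfl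

lemma sum_range_mul_div {A : Type*} [Semiring A] (F : ℕ → A) {k : ℕ} (hk : 0 < k) (m : ℕ) :
    ∑ r ∈ Finset.range (m * k), F (r / k) = k * ∑ i ∈ Finset.range m, F i := by
  induction m with
  | zero => simp
  | succ m ih =>
    rw [Nat.succ_mul, Finset.sum_range_add, ih, Finset.sum_range_succ, mul_add]
    congr 1
    rw [Finset.sum_congr rfl (g := fun _ => F m) fun r hr => ?_]
    · simp
    · rw [mul_comm m k, Nat.mul_add_div hk, Nat.div_eq_of_lt (Finset.mem_range.1 hr), add_zero]

/-- The alternating padding contributes a sum of consecutive powers of -1, which is -1, 0 or 1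
whatever its length. -/
lemma abs_sum_replicateRows_sub_le {n k : ℕ} (hk : 0 < k) (hn : m * k ≤ n) (X : Database m d)
    (j : Fin d) :
    |∑ r, signVal (replicateRows n k X r j) - k * ∑ i, signVal (X i j)| ≤ 1 := by
  set F : ℕ → ℝ := fun i => if h : i < m then signVal (X ⟨i, h⟩ j) else 0 with hF
  set g : ℕ → ℝ := fun r => if r / k < m then F (r / k) else (-1) ^ r with hg
  have h1 : ∑ r, signVal (replicateRows n k X r j) = ∑ r ∈ Finset.range n, g r := by
    rw [← Fin.sum_univ_eq_sum_range g n]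
    refine Finset.sum_congr rfl fun r _ => ?_
    simp only [hg, hF, replicateRows]
    split_ifs with h
    · rfl
    · simp [signVal]
  have h2 : ∑ i, signVal (X i j) = ∑ i ∈ Finset.range m, F i := by
    rw [← Fin.sum_univ_eq_sum_range F m]
    exact Finset.sum_congr rfl fun i _ => by simp [hF]
  have h3 : ∑ r ∈ Finset.range (m * k), g r = k * ∑ i ∈ Finset.range m, F i := by
    rw [← sum_range_mul_div F hk]
    refine Finset.sum_congr rfl fun r hr => ?_
    rw [hg]
    simp only [if_pos ((Nat.div_lt_iff_lt_mul hk).2 (Finset.mem_range.1 hr))]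
  have h4 : ∑ r ∈ Finset.Ico (m * k) n, g r = ∑ r ∈ Finset.Ico (m * k) n, (-1 : ℝ) ^ r := by
    refine Finset.sum_congr rfl fun r hr => ?_
    rw [hg]
    simp only [if_neg (not_lt.2 ((Nat.le_div_iff_mul_le hk).2 (Finset.mem_Ico.1 hr).1))]
  rw [h1, h2, ← Finset.sum_range_add_sum_Ico g hn, h3, h4, add_sub_cancel_left,
    Finset.sum_Ico_eq_sub _ hn, neg_one_geom_sum, neg_one_geom_sum]
  split_ifs <;> norm_num

/-- The answer for `X` obtained from an answer for `replicateRows n k X`. -/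
noncomputable def rescaledAnswer (q : ℝ) (y : Cube d) (j : Fin d) : ℝ :=
  max (-1) (min 1 (q * y j))

lemma measurable_rescaledAnswer (q : ℝ) (j : Fin d) :
    Measurable fun y : Cube d => rescaledAnswer q y j := by
  unfold rescaledAnswer
  fun_prop

lemma abs_rescaledAnswer_le (q : ℝ) (y : Cube d) (j : Fin d) : |rescaledAnswer q y j| ≤ 1 :=
  abs_le.2 ⟨le_max_left _ _, max_le (by norm_num) (min_le_left _ _)⟩

lemma abs_clip_sub_le {u v : ℝ} (hv : |v| ≤ 1) : |max (-1) (min 1 u) - v| ≤ |u - v| := by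
  have hv' : max (-1) (min 1 v) = v := by
    rw [min_eq_right (abs_le.1 hv).2, max_eq_right (abs_le.1 hv).1]
  calc |max (-1) (min 1 u) - v| = |max (min 1 u) (-1) - max (min 1 v) (-1)| := by
        rw [max_comm (min 1 v), hv', max_comm]
    _ ≤ |min u 1 - min v 1| := by
        rw [min_comm u, min_comm v]; exact abs_max_sub_max_le_abs _ _ _
    _ ≤ max |u - v| |(1 : ℝ) - 1| := abs_min_sub_min_le_max _ _ _ _
    _ = |u - v| := by simp

/-- The marginal of `X` is n/(mk) times that of the padded database, up to 1/(mk) from the padding.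
Clipping cannot increase the error, as the true marginal lies in [-1,1]. -/
lemma abs_rescaledAnswer_sub_le {n k : ℕ} (hm : 0 < m) (hk : 0 < k) (hn : m * k ≤ n)
    (X : Database m d) (y : Cube d) (j : Fin d) :
    |rescaledAnswer (n / (m * k)) y j - oneWayMarginal X j| ≤
      n / (m * k) * |(y j : ℝ) - oneWayMarginal (replicateRows n k X) j| + 1 / (m * k) := by
  have hn0 : 0 < n := (Nat.mul_pos hm hk).trans_le hn
  have hm' : (0 : ℝ) < m := by exact_mod_cast hm
  have hk' : (0 : ℝ) < k := by exact_mod_cast hk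
  have hn' : (0 : ℝ) < n := by exact_mod_cast hn0
  have h1 := abs_sum_replicateRows_sub_le hk hn X j
  refine (abs_clip_sub_le (abs_oneWayMarginal_le hm X j)).trans ?_
  unfold oneWayMarginal
  change |_ - 1 / (m : ℝ) * ∑ i, signVal (X i j)| ≤
    _ * |_ - 1 / (n : ℝ) * ∑ r, signVal (replicateRows n k X r j)| + _
  set S := ∑ i, signVal (X i j)
  set S' := ∑ r, signVal (replicateRows n k X r j)
  have e : n / (m * k) * (y j : ℝ) - 1 / m * S =
      n / (m * k) * ((y j : ℝ) - 1 / n * S') + 1 / (m * k) * (S' - k * S) := by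
    field_simp
    ring
  rw [e]
  refine (abs_add_le _ _).trans ?_
  rw [abs_mul, abs_mul, abs_of_nonneg (by positivity : (0 : ℝ) ≤ n / (m * k)),
    abs_of_nonneg (by positivity : (0 : ℝ) ≤ 1 / (m * k))]
  gcongr
  exact mul_le_of_le_one_right (by positivity) h1

lemma integral_rescaledAnswer_error_le {n k : ℕ} (hm : 0 < m) (hk : 0 < k) (hn : m * k ≤ n)
    (M : Mechanism n d (Cube d)) (X : Database m d) :
    ∫ y, ∑ j, |rescaledAnswer (n / (m * k)) y j - oneWayMarginal X j|
        ∂(M (replicateRows n k X) : Measure (Cube d)) ≤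
      n / (m * k) * expectedL1Error M (replicateRows n k X) + d / (m * k) := by
  set μ : Measure (Cube d) := (M (replicateRows n k X) : Measure (Cube d))
  have hI : Integrable (fun y : Cube d =>
      ∑ j, |(y j : ℝ) - oneWayMarginal (replicateRows n k X) j|) μ := by
    refine integrable_finsetSum _ fun j _ => ((Integrable.of_bound (C := 1)
      (measurable_subtype_coe.comp (measurable_pi_apply j)).aestronglyMeasurable
      (ae_of_all _ fun y => ?_)).sub (integrable_const _)).abs
    exact abs_le.2 (y j).2
  have hJ : Integrable (fun y : Cube d =>
      ∑ j, |rescaledAnswer (n / (m * k)) y j - oneWayMarginal X j|) μ :=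
    integrable_finsetSum _ fun j _ => ((Integrable.of_bound (C := 1)
      (measurable_rescaledAnswer _ j).aestronglyMeasurable
      (ae_of_all _ fun y => abs_rescaledAnswer_le _ y j)).sub (integrable_const _)).abs
  calc _ ≤ ∫ y : Cube d, (n / (m * k) * ∑ j, |(y j : ℝ) - oneWayMarginal (replicateRows n k X) j| +
        d / (m * k)) ∂μ := by
        refine integral_mono hJ ((hI.const_mul _).add (integrable_const _)) fun y => ?_
        refine (Finset.sum_le_sum fun j _ => abs_rescaledAnswer_sub_le hm hk hn X y j).trans
          (le_of_eq ?_)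
        rw [Finset.sum_add_distrib, ← Finset.mul_sum]
        simp [div_eq_mul_inv]
    _ = _ := by
        rw [integral_add (hI.const_mul _) (integrable_const _), integral_const_mul]
        simp [expectedL1Error, μ]

/-- The fingerprinting inequality for `m` groups of `k` equal rows. -/
theorem fingerprinting_inequality_of_groups {n k : ℕ} (hm : 0 < m) (hk : 0 < k) (hd : 0 < d)
    (hn : m * k ≤ n) (h12 : 12 ≤ m * k) {ε δ α : ℝ} (hε : 0 ≤ ε) (hδ : 0 ≤ δ)
    (hα : 6 * (α * n) ≤ m * k) (M : Mechanism n d (Cube d)) (hM : IsDifferentiallyPrivate M ε δ)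
    (hacc : ∀ D : Database n d, expectedL1Error M D ≤ α * d) :
    1 / 32 ≤ m * (Real.exp (k * ε - d / (9216 * m ^ 2)) + k * Real.exp (k * ε) * δ) := by
  refine fingerprinting_inequality hm hd (fun X : Database m d => M (replicateRows n k X))
    (hM.replicateRows hk hε hδ) (f := rescaledAnswer (n / (m * k)))
    (measurable_rescaledAnswer _) (abs_rescaledAnswer_le _) fun X => ?_
  refine (integral_rescaledAnswer_error_le hm hk hn M X).trans ?_
  have h12' : (12 : ℝ) ≤ m * k := by exact_mod_cast h12
  have h0 : (0 : ℝ) < m * k := by linarith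
  have hd0 : (0 : ℝ) ≤ d := by positivity
  -- The two hypotheses on mk bound the summands by d/6 and d/12, which together are d/4.
  calc _ ≤ n / (m * k) * (α * d) + d / (m * k) := by gcongr; exact hacc _
    _ = (α * n + 1) * d / (m * k) := by field_simp
    _ ≤ d / 4 := by
      rw [div_le_iff₀ h0]
      nlinarith

end Replication

/-! ### Choice of the group size and the final bounds. -/

/-- The bound on the dimension, with `L = log (1 / δ)` and explicit constants. -/
theorem dimension_mul_log_le {n d : ℕ} {ε L α a c γ : ℝ} (hn : 0 < n) (hd : 0 < d) (hε : 0 < ε)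
    (hα : 0 < α) (hα10 : α ≤ 1 / 10) (hγ : 0 < γ) (ha : 0 < a)
    (haγ : a * (4 * (1 + γ)) ≤ γ) (hac : 2 * (a * c) ≤ 1) (hL3 : 3 ≤ a * L) (hLε : ε ≤ a * L)
    (hLα : L ≤ c * (ε * α * n)) (hαn : 2 ≤ α * n) (hLn : (1 + γ) * Real.log n ≤ L)
    (M : Mechanism n d (Cube d)) (hM : IsDifferentiallyPrivate M ε (Real.exp (-L)))
    (hacc : ∀ D : Database n d, expectedL1Error M D ≤ α * d) :
    d * L ≤ (672 / a * (ε * α * n)) ^ 2 := by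
  have hL : 0 < L := by
    by_contra h
    nlinarith
  have hn' : (0 : ℝ) < n := by exact_mod_cast hn
  -- Groups are as large as possible while exp(kε) ≤ exp(2aL) remains a small power of 1/δ.
  set k : ℕ := ⌈a * L / ε⌉₊ with hk
  have hk1 : a * L / ε ≤ k := Nat.le_ceil _
  have hk2 : (k : ℝ) < a * L / ε + 1 := Nat.ceil_lt_add_one (by positivity)
  have hk0 : 0 < k := Nat.ceil_pos.2 (by positivity)
  have hk0' : (0 : ℝ) < k := by exact_mod_cast hk0
  have hkε1 : a * L ≤ k * ε := (div_le_iff₀ hε).1 hk1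
  have hkε2 : k * ε ≤ 2 * (a * L) := by
    have : k * ε ≤ (a * L / ε + 1) * ε := by gcongr
    rw [add_mul, div_mul_cancel₀ _ hε.ne'] at this
    linarith
  have hkα : k ≤ α * n := by
    refine le_of_mul_le_mul_right ?_ hε
    have : a * L ≤ a * (c * (ε * α * n)) := by gcongr
    have h2 : 2 * (a * c) * (ε * α * n) ≤ 1 * (ε * α * n) := by gcongr
    linarith
  -- The least number of groups that keeps the rescaled error small. As k ≤ αn, rounding costs at
  -- most αn, and 7αn ≤ n.
  set m : ℕ := ⌈6 * (α * n) / k⌉₊ with hm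
  have hm1 : 6 * (α * n) / k ≤ m := Nat.le_ceil _
  have hm2 : (m : ℝ) < 6 * (α * n) / k + 1 := Nat.ceil_lt_add_one (by positivity)
  have hm0 : 0 < m := Nat.ceil_pos.2 (by positivity)
  have hm0' : (0 : ℝ) < m := by exact_mod_cast hm0
  have hmk1 : 6 * (α * n) ≤ m * k := (div_le_iff₀ hk0').1 hm1
  have hmk2 : m * k ≤ 7 * (α * n) := by
    have : m * k ≤ (6 * (α * n) / k + 1) * k := by gcongr
    rw [add_mul, div_mul_cancel₀ _ hk0'.ne'] at this
    linarith
  have hmkn : (m : ℝ) * k ≤ n := by nlinarith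
  have h12 : (12 : ℝ) ≤ m * k := by linarith
  have hmn : (m : ℝ) ≤ n := by
    have : (1 : ℝ) ≤ k := by exact_mod_cast hk0
    nlinarith
  have hkey := fingerprinting_inequality_of_groups hm0 hk0 hd (by exact_mod_cast hmkn)
    (by exact_mod_cast h12) hε.le (Real.exp_pos (-L)).le hmk1 M hM hacc
  -- The slack γ in δ ≤ n^(-1-γ) pays for group privacy: 2aL absorbs exp(kε), and the other 2aL ≥ 6
  -- gives the constant factor exp(-6) ≤ 1/64.
  have hlogn : Real.log n ≤ L - 4 * (a * L) := by
    have h1 : 0 ≤ (γ - a * (4 * (1 + γ))) * L := mul_nonneg (by linarith) hL.le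
    refine le_of_mul_le_mul_left (a := 1 + γ) ?_ (by positivity)
    linarith
  have hexp6 : Real.exp (-6) ≤ 1 / 64 := by
    have h1 : (2 : ℝ) ≤ Real.exp 1 := by linarith [Real.add_one_le_exp (1 : ℝ)]
    have h2 : (64 : ℝ) ≤ Real.exp 6 := by
      calc (64 : ℝ) = 2 ^ 6 := by norm_num
        _ ≤ Real.exp 1 ^ 6 := by gcongr
        _ = Real.exp 6 := by rw [← Real.exp_nat_mul]; norm_num
    rw [Real.exp_neg, ← one_div]
    gcongr
  have hsmall : m * (k * Real.exp (k * ε) * Real.exp (-L)) ≤ 1 / 64 := by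
    calc _ = m * k * (Real.exp (k * ε) * Real.exp (-L)) := by ring
      _ ≤ n * (Real.exp (2 * (a * L)) * Real.exp (-L)) := by gcongr
      _ = Real.exp (Real.log n + 2 * (a * L) - L) := by
        rw [sub_eq_add_neg, Real.exp_add, Real.exp_add, Real.exp_log hn', mul_assoc]
      _ ≤ Real.exp (-6) := Real.exp_le_exp.2 (by linarith)
      _ ≤ 1 / 64 := hexp6
  have hlarge : 1 / 64 ≤ m * Real.exp (k * ε - d / (9216 * m ^ 2)) := by
    rw [mul_add] at hkey; linarith
  have hd1 : (d : ℝ) / (9216 * m ^ 2) ≤ L := by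
    have h2 : m * Real.exp (k * ε - d / (9216 * m ^ 2)) ≤
        Real.exp (Real.log n + 2 * (a * L) - d / (9216 * m ^ 2)) := by
      rw [add_sub_assoc, Real.exp_add, Real.exp_log hn']
      gcongr
    have h3 := Real.exp_le_exp.1 (hexp6.trans (hlarge.trans h2))
    linarith
  have hmL : m * L ≤ 7 / a * (ε * α * n) := by
    rw [div_mul_eq_mul_div, le_div_iff₀ ha]
    calc m * L * a = m * (a * L) := by ring
      _ ≤ m * (k * ε) := by gcongr
      _ = m * k * ε := by ring
      _ ≤ 7 * (α * n) * ε := by gcongr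
      _ = _ := by ring
  rw [div_le_iff₀ (by positivity)] at hd1
  calc d * L ≤ L * (9216 * m ^ 2) * L := by gcongr
    _ = (96 * (m * L)) ^ 2 := by ring
    _ ≤ (96 * (7 / a * (ε * α * n))) ^ 2 := by gcongr
    _ = _ := by ring

theorem sample_complexity_lower_bound (c γ ε₀ : ℝ) (hc : 0 < c) (hγ : 0 < γ) (hε₀ : 0 < ε₀) :
    ∃ κ : ℝ, 0 < κ ∧ ∃ n₀ : ℕ, 2 ≤ n₀ ∧
      ∀ (n d : ℕ) (ε δ α : ℝ) (M : Mechanism n d (Cube d)),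
        n₀ ≤ n →
        0 < ε → ε ≤ ε₀ →
        0 < α → α ≤ 1 / 10 →
        (2 : ℝ) ^ (-(c * (ε * α * (n : ℝ)))) ≤ δ →
        δ ≤ 1 / (n : ℝ) ^ (1 + γ) →
        IsDifferentiallyPrivate M ε δ →
        (∀ D : Database n d, expectedL1Error M D ≤ α * (d : ℝ)) →
        κ * (Real.sqrt ((d : ℝ) * Real.log (1 / δ)) / (ε * α)) ≤ (n : ℝ) := by
  set a : ℝ := min (γ / (4 * (1 + γ))) (1 / (2 * c)) with ha
  have ha0 : 0 < a := by rw [ha]; positivity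
  have haγ : a * (4 * (1 + γ)) ≤ γ :=
    (le_div_iff₀ (by positivity)).1 (min_le_left _ _)
  have hac : 2 * (a * c) ≤ 1 := by
    have := (le_div_iff₀ (by positivity : 0 < 2 * c)).1 (min_le_right _ _ : a ≤ 1 / (2 * c))
    linarith
  -- The three terms in the exponent ensure aL ≥ 3, aL ≥ ε and, through L ≤ cεαn, αn ≥ 2.
  refine ⟨a / 672, by positivity,
    max 2 ⌈Real.exp (3 / a + ε₀ / a + 2 * (c * ε₀))⌉₊, le_max_left _ _, ?_⟩
  intro n d ε δ α M hn hε hεε₀ hα hα10 hδ1 hδ2 hM hacc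
  have hn2 : 2 ≤ n := (le_max_left _ _).trans hn
  have hn' : (0 : ℝ) < n := by exact_mod_cast (by omega : 0 < n)
  have hδ0 : 0 < δ := lt_of_lt_of_le (by positivity) hδ1
  set L := Real.log (1 / δ) with hL
  have hLδ : Real.log δ = -L := by rw [hL, one_div, Real.log_inv, neg_neg]
  have hδL : δ = Real.exp (-L) := by rw [← hLδ, Real.exp_log hδ0]
  have hlogn : 3 / a + ε₀ / a + 2 * (c * ε₀) ≤ Real.log n := by
    rw [Real.le_log_iff_exp_le hn']
    exact (Nat.le_ceil _).trans (by exact_mod_cast (le_max_right _ _).trans hn)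
  have hLn : (1 + γ) * Real.log n ≤ L := by
    have h := Real.log_le_log hδ0 hδ2
    rw [hLδ, one_div, Real.log_inv, Real.log_rpow hn'] at h
    linarith
  have hLα : L ≤ c * (ε * α * n) := by
    have h := Real.log_le_log (by positivity) hδ1
    rw [hLδ, Real.log_rpow two_pos] at h
    have h2 : Real.log 2 ≤ 1 := by linarith [Real.log_two_lt_d9]
    have h3 : c * (ε * α * n) * Real.log 2 ≤ c * (ε * α * n) :=
      mul_le_of_le_one_right (by positivity) h2
    linarith
  have hp1 : 0 < 3 / a := by positivity
  have hp2 : 0 < ε₀ / a := by positivity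
  have hp3 : 0 < c * ε₀ := by positivity
  have hLlog : Real.log n ≤ L := by nlinarith
  have hL3 : 3 ≤ a * L := by
    rw [mul_comm, ← div_le_iff₀ ha0]; linarith
  have hLε : ε ≤ a * L := by
    refine hεε₀.trans ?_
    rw [mul_comm, ← div_le_iff₀ ha0]; linarith
  have hαn : 2 ≤ α * n := by
    refine le_of_mul_le_mul_left (a := c * ε₀) ?_ hp3
    have : c * (ε * α * n) ≤ c * (ε₀ * α * n) := by gcongr
    linarith
  rcases Nat.eq_zero_or_pos d with rfl | hd
  · simp
  have hmain := dimension_mul_log_le (by omega) hd hε hα hα10 hγ ha0 haγ hac hL3 hLε hLα hαn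
    hLn M (hδL ▸ hM) hacc
  have hsqrt := Real.sqrt_le_sqrt hmain
  rw [Real.sqrt_sq (by positivity)] at hsqrt
  calc a / 672 * (Real.sqrt (d * L) / (ε * α)) ≤
      a / 672 * (672 / a * (ε * α * n) / (ε * α)) := by gcongr
    _ = n := by field_simp

theorem theorem3p1 :
    (∀ c γ : ℝ, 0 < c → 0 < γ →
      ∃ K : ℝ, 0 < K ∧ ∃ n₀ : ℕ,
        ∀ (n d : ℕ) (δ : ℝ) (M : Mechanism n d (Cube d)),
          n₀ ≤ n →
          (2 : ℝ) ^ (-(c * (n : ℝ))) ≤ δ →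
          δ ≤ 1 / (n : ℝ) ^ (1 + γ) →
          IsDifferentiallyPrivate M 1 δ →
          (∀ D : Database n d, expectedL1Error M D ≤ (d : ℝ) / 10) →
          (d : ℝ) ≤ K * ((n : ℝ) ^ 2 / Real.log (1 / δ))) ∧
    (∀ c γ ε₀ : ℝ, 0 < c → 0 < γ → 0 < ε₀ →
      ∃ κ : ℝ, 0 < κ ∧ ∃ n₀ : ℕ,
        ∀ (n d : ℕ) (ε δ α : ℝ) (M : Mechanism n d (Cube d)),
          n₀ ≤ n →
          0 < ε → ε ≤ ε₀ →
          0 < α → α ≤ 1 / 10 →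
          (2 : ℝ) ^ (-(c * (ε * α * (n : ℝ)))) ≤ δ →
          δ ≤ 1 / (n : ℝ) ^ (1 + γ) →
          IsDifferentiallyPrivate M ε δ →
          (∀ D : Database n d, expectedL1Error M D ≤ α * (d : ℝ)) →
          κ * (Real.sqrt ((d : ℝ) * Real.log (1 / δ)) / (ε * α)) ≤ (n : ℝ)) := by
  refine ⟨fun c γ hc hγ => ?_, fun c γ ε₀ hc hγ hε₀ => ?_⟩
  -- The factor 10 compensates for α = 1/10 in the lower bound on δ; n₀ ≥ 2 makes log(1/δ) positive.
  · obtain ⟨κ, hκ, n₀, hn₀, h⟩ := sample_complexity_lower_bound (10 * c) γ 1 (by positivity) hγ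
      one_pos
    refine ⟨1 / (100 * κ ^ 2), by positivity, n₀, fun n d δ M hn hδ1 hδ2 hM hacc => ?_⟩
    have hδ0 : 0 < δ := lt_of_lt_of_le (by positivity) hδ1
    have hn1 : (1 : ℝ) < n := by exact_mod_cast (by omega : 1 < n)
    have hL : 0 < Real.log (1 / δ) := by
      refine Real.log_pos ((one_lt_div hδ0).2 (hδ2.trans_lt ?_))
      rw [div_lt_one (by positivity)]
      exact Real.one_lt_rpow hn1 (by positivity)
    have hmain := h n d 1 δ (1 / 10) M hn one_pos le_rfl (by norm_num) le_rfl
      (by convert hδ1 using 3; ring) hδ2 hM fun D => (hacc D).trans (le_of_eq (by ring))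
    have h1 : κ * 10 * Real.sqrt (d * Real.log (1 / δ)) ≤ n := by
      refine le_trans (le_of_eq ?_) hmain
      ring
    have h2 : (κ * 10 * Real.sqrt (d * Real.log (1 / δ))) ^ 2 ≤ (n : ℝ) ^ 2 := by gcongr
    rw [mul_pow, Real.sq_sqrt (by positivity)] at h2
    rw [← mul_div_assoc, le_div_iff₀ hL, one_div_mul_eq_div, le_div_iff₀ (by positivity)]
    linarith
  · obtain ⟨κ, hκ, n₀, -, h⟩ := sample_complexity_lower_bound c γ ε₀ hc hγ hε₀
    exact ⟨κ, hκ, n₀, h⟩
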